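/- All spaces are Tychonoff. Let $G$ be a semitopological group, that is, a group with a topology for which all left and right translations of $G$ are continuous, and suppose that $G$ is $\omega$-narrow: for every neighbourhood $U$ of the identity there is a countable set $A\subset G$ with $UA=AU=G$. Let $X$ be a pseudocompact space (every continuous real-valued function on $X$ is bounded), and let $G$ act on $X$ from the left so that * the action is separately continuous: for all $g\in G$ and $x\in X$ the maps $X\to X$, $y\mapsto gy$, and $G\to X$, $h\mapsto hx$, are continuous; * the action is transitive: for every $x\in X$ the map $G\to X$, $g\mapsto gx$, is surjective; * the action is an $s$-action: for every continuous $f:X\to\mathbb R$ the set of functions $\{x\mapsto f(gx) : g\in G\}$ is separable in the topology of pointwise convergence. Then $X$ is skeletally Dugundji, that is, there are a nonzero cardinal $\tau$ and an inverse system $S=\{X_\alpha,p^\beta_\alpha,\alpha<\beta<\tau\}$ of Tychonoff spaces indexed by the ordinals less than $\tau$, whose bonding maps $p^\beta_\alpha:X_\beta\to X_\alpha$ are surjective and skeletal (continuous, with $\operatorname{Int}\overline{p^\beta_\alpha(U)}\ne\varnothing$ for every nonempty open $U\subset X_\beta$), such that 1. $X_0$ is separable metrizable, and whenever $\alpha+1<\tau$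 the map $p^{\alpha+1}_\alpha$ has a metrizable kernel: there are a separable metrizable space $M_\alpha$ and a topological embedding of $X_{\alpha+1}$ in $X_\alpha\times M_\alpha$ under which $p^{\alpha+1}_\alpha$ becomes the restriction of the projection $X_\alpha\times M_\alpha\to X_\alpha$; 2. for every limit ordinal $\gamma<\tau$, the canonical map $X_\gamma\to\varprojlim\{X_\alpha,p^\beta_\alpha,\alpha<\beta<\gamma\}$ is a topological embedding with dense image; 3. there is a topological embedding $X\subset\varprojlim S$ such that $p_\alpha(X)=X_\alpha$ for every $\alpha<\tau$, where $p_\alpha:\varprojlim S\to X_\alpha$ is the limit projection; 4. for every bounded continuous $f:\varprojlim S\to\mathbb R$ there are $\alpha<\tau$ and a continuous $g:X_\alpha\to\mathbb R$ with $f=g\circ p_\alpha$. -/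

import Mathlib

open Set Topology Pointwise

universe u v

/-- A topological space on which every continuous real-valued function is bounded. (The Tychonoff
separation axiom is imposed separately, by `T35Space`.) -/
def IsPseudocompact (X : Type u) [TopologicalSpace X] : Prop :=
  ∀ f : C(X, ℝ), ∃ M : ℝ, ∀ x : X, |f x| ≤ M

/-- A group with a topology is `ω`-narrow if for every neighbourhood `U` of the identity there is a
countable set `A` with `U * A = A * U = G`. -/
def IsOmegaNarrow (G : Type v) [Group G] [TopologicalSpace G] : Prop :=
  ∀ U ∈ 𝓝 (1 : G), ∃ A : Set G, A.Countable ∧ U * A = univ ∧ A * U = univ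

/-- The action `(g, x) ↦ g • x` is separately continuous: all translations `x ↦ g • x` and all orbit
maps `g ↦ g • x` are continuous. -/
def IsSeparatelyContinuousAction (G : Type v) (X : Type u) [Group G] [TopologicalSpace G]
    [TopologicalSpace X] [MulAction G X] : Prop :=
  (∀ g : G, Continuous fun x : X => g • x) ∧ ∀ x : X, Continuous fun g : G => g • x

/-- The orbit `{x ↦ f (g • x) : g ∈ G}` of a continuous function `f` under the induced right action
of `G` on functions. It is a subset of the product `X → ℝ`, whose topology is that of pointwise
convergence, so that the subspace topology on the orbit is the one it has in `C_p(X)`. -/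
def functionOrbit (G : Type v) {X : Type u} [Group G] [TopologicalSpace X] [MulAction G X]
    (f : C(X, ℝ)) : Set (X → ℝ) :=
  range fun (g : G) (x : X) => f (g • x)

/-- An `s`-action: for every continuous `f : X → ℝ`, the orbit of `f` is a separable space in the
topology of pointwise convergence. -/
def IsSAction (G : Type v) (X : Type u) [Group G] [TopologicalSpace X] [MulAction G X] : Prop :=
  ∀ f : C(X, ℝ), TopologicalSpace.SeparableSpace (functionOrbit G f)

/-- A continuous map is skeletal if the closure of the image of every nonempty open set has nonempty
interior. -/
def IsSkeletal {X Y : Type*} [TopologicalSpace X] [TopologicalSpace Y] (f : X → Y) : Prop :=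
  Continuous f ∧ ∀ U : Set X, IsOpen U → U.Nonempty → (interior (closure (f '' U))).Nonempty

/-- `p : Y → X` has a metrizable kernel: for some separable metrizable `M`, `Y` embeds in `X × M` in
such a way that `p` becomes the restriction of the projection `X × M → X`. -/
def HasMetrizableKernel {X Y : Type u} [TopologicalSpace X] [TopologicalSpace Y] (p : Y → X) :
    Prop :=
  ∃ (M : Type u) (_ : TopologicalSpace M) (e : Y → X × M),
    TopologicalSpace.MetrizableSpace M ∧ TopologicalSpace.SeparableSpace M ∧
      IsEmbedding e ∧ ∀ y, (e y).1 = p y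

/-- An inverse system of Tychonoff spaces and continuous maps, indexed by the ordinals `< τ`. -/
structure WellOrderedSystem (τ : Ordinal.{u}) where
  space : Iio τ → Type u
  top : ∀ α, TopologicalSpace (space α)
  tychonoff : ∀ α, T35Space (space α)
  /-- the bonding map from stage `β` to stage `α` -/
  map : ∀ {α β : Iio τ}, α ≤ β → space β → space α
  continuous_map : ∀ {α β : Iio τ} (h : α ≤ β), Continuous (map h)
  map_refl : ∀ (α : Iio τ) (x : space α), map (le_refl α) x = x
  map_map : ∀ {α β γ : Iio τ} (h : α ≤ β) (k : β ≤ γ) (x : space γ),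
    map h (map k x) = map (h.trans k) x

namespace WellOrderedSystem

attribute [instance] top tychonoff

variable {τ : Ordinal.{u}} (S : WellOrderedSystem τ)

/-- The limit of the part of the system indexed by a set `I` of indices, the space of threads in the
product. It carries the subspace topology of the product topology. -/
def limit (I : Set (Iio τ)) : Set (∀ α : I, S.space α) :=
  {x | ∀ (α β : I) (h : (α : Iio τ) ≤ β), S.map h (x β) = x α}

/-- The canonical map from stage `γ` to the limit of the stages before `γ`. -/
def toLimit (γ : Iio τ) (x : S.space γ) : S.limit (Iio γ) :=
  ⟨fun α => S.map (le_of_lt α.2) x, fun _ _ h => S.map_map h _ x⟩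

/-- The limit of the whole system. -/
abbrev fullLimit : Set (∀ α : (univ : Set (Iio τ)), S.space α) := S.limit univ

/-- The limit projections. -/
def proj (α : Iio τ) (x : S.fullLimit) : S.space α := x.1 ⟨α, mem_univ α⟩

/-- At every limit ordinal `γ < τ`, the space at stage `γ` is, through the canonical map, a dense
subspace of the limit of the earlier stages. -/
def IsAlmostContinuous : Prop :=
  ∀ γ : Iio τ, Order.IsSuccLimit (γ : Ordinal.{u}) →
    IsEmbedding (S.toLimit γ) ∧ DenseRange (S.toLimit γ)

/-- `X` is an almost limit of the system: it embeds in the limit in such a way that every limit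
projection maps it onto the corresponding stage. -/
def IsAlmostLimit (X : Type u) [TopologicalSpace X] : Prop :=
  ∃ e : X → S.fullLimit, IsEmbedding e ∧ ∀ α : Iio τ, Function.Surjective fun x => S.proj α (e x)

/-- Every bounded continuous real-valued function on the limit factors, continuously, through one of
the stages. -/
def IsFactorizing : Prop :=
  ∀ f : C(S.fullLimit, ℝ), (∃ M : ℝ, ∀ x, |f x| ≤ M) →
    ∃ (α : Iio τ) (g : C(S.space α, ℝ)), ∀ x, f x = g (S.proj α x)

end WellOrderedSystem

/-- Skeletally Dugundji spaces. The length of the system is (the initial ordinal of) a nonzero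
cardinal `τ`, so that there is a stage `0`. -/
def IsSkeletallyDugundji (X : Type u) [TopologicalSpace X] : Prop :=
  ∃ (τ : Cardinal.{u}) (S : WellOrderedSystem τ.ord), 0 < τ ∧
    (∀ (α β : Iio τ.ord) (h : α ≤ β), Function.Surjective (S.map h) ∧ IsSkeletal (S.map h)) ∧
    (∀ α : Iio τ.ord, (α : Ordinal.{u}) = 0 →
      TopologicalSpace.MetrizableSpace (S.space α) ∧
        TopologicalSpace.SeparableSpace (S.space α)) ∧
    (∀ (α β : Iio τ.ord) (h : α ≤ β), (β : Ordinal.{u}) = Order.succ (α : Ordinal.{u}) →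
      HasMetrizableKernel (S.map h)) ∧
    S.IsAlmostContinuous ∧ S.IsAlmostLimit X ∧ S.IsFactorizing

/-! Call a family of functions stable if translates of its members factor through the diagonal image
of `X`; then `G` acts on that image by homeomorphisms. For an `s`-action, countably many translates
of `f` determine on which pairs of points all translates of `f` agree. Closing off in `ω` steps puts
`f` in a countable family `c f`, which is stable because countable families have compact images, so
that a function constant on the fibres factors continuously.

Unions of stable families are stable, and a stable family gives a skeletal map: by `ω`-narrowness
and transitivity, countably many translates of a nonempty open set cover `X`. The image is
pseudocompact, hence Baire, so the image of one translate is somewhere dense, and the action carries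
this back.

Now well-order `C(X, ℝ)` and let stage `α` be the image under the union of the `c f` with `f` of
rank below `α`. Successor steps add at most one countable family, limit stages are unions, and some
stage before `τ` uses all of `C(X, ℝ)` and is therefore a copy of `X`. -/

/-! ### Pseudocompact spaces -/

/-- A decreasing sequence of nonempty open sets in a pseudocompact Tychonoff space has a common
adherent point. -/
theorem IsPseudocompact.nonempty_iInter_closure {Y : Type u} [TopologicalSpace Y] [T35Space Y]
    (hY : IsPseudocompact Y) {U : ℕ → Set Y} (hU : Antitone U) (hopen : ∀ n, IsOpen (U n))
    (hne : ∀ n, (U n).Nonempty) : (⋂ n, closure (U n)).Nonempty := by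
  by_contra hempty
  rw [not_nonempty_iff_eq_empty] at hempty
  choose x hx using hne
  have hbump : ∀ n, ∃ f : Y → ℝ, Continuous f ∧ f (x n) = n ∧ (∀ y, 0 ≤ f y) ∧
      ∀ y ∉ U n, f y = 0 := by
    intro n
    obtain ⟨f, hf, hf0, hf1⟩ := CompletelyRegularSpace.completely_regular (x n) (U n)ᶜ
      (hopen n).isClosed_compl (by simpa using hx n)
    refine ⟨fun y => n * (1 - (f y : ℝ)), by fun_prop, by simp [hf0], fun y => ?_, fun y hy => ?_⟩
    · exact mul_nonneg (Nat.cast_nonneg n) (sub_nonneg.2 (f y).2.2)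
    · simp [hf1 (mem_compl hy)]
  choose f hfc hfx hf0 hfU using hbump
  have hlf : LocallyFinite fun n => Function.support (f n) := by
    intro y
    have : y ∉ ⋂ n, closure (U n) := by simp [hempty]
    obtain ⟨n, hn⟩ := by simpa only [mem_iInter, not_forall] using this
    refine ⟨(closure (U n))ᶜ, isClosed_closure.isOpen_compl.mem_nhds hn,
      (finite_lt_nat n).subset ?_⟩
    rintro m ⟨z, hz, hzn⟩
    by_contra hmn
    refine hz (hfU m z fun hzm => hzn (subset_closure (hU (not_lt.1 hmn) hzm)))
  -- The sum of the bumps is continuous by local finiteness, and at least `n` at `x n`.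
  obtain ⟨M, hM⟩ := hY ⟨fun y => ∑ᶠ n, f n y, continuous_finsum hfc hlf⟩
  obtain ⟨n, hn⟩ := exists_nat_gt M
  have hle : f n (x n) ≤ ∑ᶠ m, f m (x n) :=
    single_le_finsum n (hlf.point_finite (x n)) fun m => hf0 m (x n)
  have := (le_abs_self _).trans (hM (x n))
  simp only [ContinuousMap.coe_mk] at this
  rw [hfx] at hle
  linarith

/-- Pseudocompact Tychonoff spaces are Baire. -/
theorem IsPseudocompact.baireSpace {Y : Type u} [TopologicalSpace Y] [T35Space Y]
    (hY : IsPseudocompact Y) : BaireSpace Y := by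
  refine ⟨fun f hfo hfd => dense_iff_inter_open.2 fun W hW hWne => ?_⟩
  have hstep : ∀ (n : ℕ) (V : {V : Set Y // IsOpen V ∧ V.Nonempty}),
      ∃ V' : {V : Set Y // IsOpen V ∧ V.Nonempty}, closure V'.1 ⊆ V.1 ∩ f n := by
    rintro n ⟨V, hV, hVne⟩
    obtain ⟨y, hy⟩ := (hfd n).inter_open_nonempty V hV hVne
    obtain ⟨t, ht, htc, hts⟩ :=
      exists_mem_nhds_isClosed_subset ((hV.inter (hfo n)).mem_nhds hy)
    exact ⟨⟨interior t, isOpen_interior, y, mem_interior_iff_mem_nhds.2 ht⟩,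
      (closure_minimal interior_subset htc).trans hts⟩
  choose next hnext using hstep
  let V : ℕ → {V : Set Y // IsOpen V ∧ V.Nonempty} := fun n =>
    n.rec ⟨W, hW, hWne⟩ fun n V => next n V
  have hV : ∀ n, closure (V (n + 1)).1 ⊆ (V n).1 ∩ f n := fun n => hnext n (V n)
  have hanti : Antitone fun n => (V n).1 :=
    antitone_nat_of_succ_le fun n => subset_closure.trans ((hV n).trans inter_subset_left)
  obtain ⟨y, hy⟩ := hY.nonempty_iInter_closure hanti (fun n => (V n).2.1) fun n => (V n).2.2
  have hy' : ∀ n, y ∈ (V n).1 ∩ f n := fun n => hV n (mem_iInter.1 hy (n + 1))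
  exact ⟨y, (hy' 0).1, mem_iInter.2 fun n => (hy' n).2⟩

theorem IsPseudocompact.of_surjective {X Y : Type u} [TopologicalSpace X] [TopologicalSpace Y]
    (hX : IsPseudocompact X) {p : X → Y} (hp : Continuous p) (hsurj : Function.Surjective p) :
    IsPseudocompact Y := by
  intro f
  obtain ⟨M, hM⟩ := hX (f.comp ⟨p, hp⟩)
  exact ⟨M, hsurj.forall.2 hM⟩

/-! ### Diagonal images of families of functions -/

section EvaluationImage

variable {X : Type u} [TopologicalSpace X]

/-- The image of `X` in `ℝ^F` under the diagonal product of a family `F` of functions. -/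
abbrev evalImage (F : Set C(X, ℝ)) : Type u :=
  range fun (x : X) (f : F) => f.1 x

/-- The diagonal product of a family `F` of functions, as a map onto its image. -/
def toEvalImage (F : Set C(X, ℝ)) (x : X) : evalImage F :=
  ⟨fun f => f.1 x, x, rfl⟩

theorem continuous_toEvalImage (F : Set C(X, ℝ)) : Continuous (toEvalImage F) :=
  Continuous.subtype_mk (continuous_pi fun f => f.1.continuous) _

theorem surjective_toEvalImage (F : Set C(X, ℝ)) : Function.Surjective (toEvalImage F) := by
  rintro ⟨_, x, rfl⟩
  exact ⟨x, rfl⟩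

/-- The restriction of families of values to a smaller family of functions. -/
def evalImageMap {F H : Set C(X, ℝ)} (h : F ⊆ H) (y : evalImage H) : evalImage F :=
  ⟨fun f => y.1 ⟨f.1, h f.2⟩, by
    obtain ⟨_, x, rfl⟩ := y
    exact ⟨x, rfl⟩⟩

theorem continuous_evalImageMap {F H : Set C(X, ℝ)} (h : F ⊆ H) :
    Continuous (evalImageMap h) :=
  Continuous.subtype_mk (continuous_pi fun f =>
    (continuous_apply (⟨f.1, h f.2⟩ : H)).comp continuous_subtype_val) _

theorem surjective_evalImageMap {F H : Set C(X, ℝ)} (h : F ⊆ H) :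
    Function.Surjective (evalImageMap h) := by
  rintro ⟨_, x, rfl⟩
  exact ⟨toEvalImage H x, rfl⟩

theorem hasMetrizableKernel_evalImageMap {F H : Set C(X, ℝ)} (h : F ⊆ H)
    (hc : (H \ F).Countable) : HasMetrizableKernel (evalImageMap h) := by
  have := hc.to_subtype
  let r : evalImage H → ((H \ F : Set C(X, ℝ)) → ℝ) := fun y f => y.1 ⟨f.1, f.2.1⟩
  have hr : Continuous r := continuous_pi fun f =>
    (continuous_apply (⟨f.1, f.2.1⟩ : H)).comp continuous_subtype_val
  refine ⟨_, inferInstance, fun y => (evalImageMap h y, r y), inferInstance, inferInstance, ?_,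
    fun _ => rfl⟩
  classical
  -- `s` reassembles a point of `ℝ^H` from its two parts, so its composite with the candidate
  -- embedding is the inclusion.
  let s : evalImage F × ((H \ F : Set C(X, ℝ)) → ℝ) → (H → ℝ) := fun z f =>
    if hf : f.1 ∈ F then z.1.1 ⟨f.1, hf⟩ else z.2 ⟨f.1, f.2, hf⟩
  have hs : Continuous s := continuous_pi fun f => by
    by_cases hf : f.1 ∈ F
    · simp only [s, dif_pos hf]
      exact (continuous_apply _).comp (continuous_subtype_val.comp continuous_fst)
    · simp only [s, dif_neg hf]
      exact (continuous_apply _).comp continuous_snd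
  refine .of_comp ((continuous_evalImageMap h).prodMk hr) hs ?_
  convert IsEmbedding.subtypeVal (p := (· ∈ range fun (x : X) (f : H) => f.1 x)) using 1
  funext y f
  by_cases hf : f.1 ∈ F <;> simp [s, hf, r, evalImageMap]

theorem isEmbedding_toEvalImage_univ [T35Space X] :
    IsEmbedding (toEvalImage (univ : Set C(X, ℝ))) := by
  have hind : IsInducing (toEvalImage (univ : Set C(X, ℝ))) := by
    refine isInducing_iff_nhds.2 fun x => le_antisymm
      (continuous_toEvalImage _).continuousAt.tendsto.le_comap fun U hU => ?_
    obtain ⟨f, hf, hf0, hf1⟩ := CompletelyRegularSpace.completely_regular x (interior U)ᶜ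
      isOpen_interior.isClosed_compl (by simpa [mem_interior_iff_mem_nhds] using hU)
    let φ : C(X, ℝ) := ⟨fun y => f y, by fun_prop⟩
    have hφ : Continuous fun y : evalImage (univ : Set C(X, ℝ)) => y.1 ⟨φ, trivial⟩ :=
      (continuous_apply _).comp continuous_subtype_val
    refine Filter.mem_comap.2 ⟨_, (isOpen_Iio.preimage hφ).mem_nhds
      (show (f x : ℝ) < 1 by simp [hf0]), fun y hy => interior_subset ?_⟩
    by_contra hyU
    exact absurd (show (f y : ℝ) < 1 from hy) (by simp [hf1 hyU])
  exact hind.isEmbedding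

/-- The image of a pseudocompact space under a countable family of functions is compact. -/
theorem IsPseudocompact.compactSpace_evalImage (hX : IsPseudocompact X) {F : Set C(X, ℝ)}
    (hF : F.Countable) : CompactSpace (evalImage F) := by
  have := hF.to_subtype
  let := TopologicalSpace.metrizableSpaceMetric (F → ℝ)
  choose M hM using hX
  have hsub : (range fun (x : X) (f : F) => f.1 x) ⊆ univ.pi fun f : F => Icc (-M f.1) (M f.1) := by
    rintro _ ⟨x, rfl⟩ f -
    exact abs_le.1 (hM f.1 x)
  have hcl : IsClosed (range fun (x : X) (f : F) => f.1 x) := by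
    refine isClosed_of_closure_subset fun y hy => ?_
    by_contra hyn
    have hpos : ∀ x : X, dist (fun f : F => f.1 x) y ≠ 0 := fun x h =>
      hyn ⟨x, dist_eq_zero.1 h⟩
    have hdc : Continuous fun x : X => dist (fun f : F => f.1 x) y :=
      (continuous_pi fun f : F => f.1.continuous).dist continuous_const
    -- If the image missed its limit point `y`, the reciprocal distance to `y` would be unbounded.
    let φ : C(X, ℝ) := ⟨fun x => (dist (fun f : F => f.1 x) y)⁻¹, hdc.inv₀ hpos⟩
    have hbd := hM φ
    obtain ⟨_, ⟨x, rfl⟩, hx⟩ := Metric.mem_closure_iff.1 hy (|M φ| + 1)⁻¹ (by positivity)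
    rw [dist_comm] at hx
    have h1 := lt_inv_of_lt_inv₀ ((dist_nonneg).lt_of_ne' (hpos x)) hx
    have h2 := (le_abs_self _).trans (hbd x)
    have h3 := le_abs_self (M φ)
    simp only [φ, ContinuousMap.coe_mk] at h1 h2
    linarith
  exact isCompact_iff_compactSpace.1
    ((isCompact_univ_pi fun f => isCompact_Icc).of_isClosed_subset hcl hsub)

/-- A function on a pseudocompact space that is constant on the fibres of a countable family of
functions factors continuously through the image of that family. -/
theorem IsPseudocompact.exists_factorization (hX : IsPseudocompact X) {F : Set C(X, ℝ)}
    (hF : F.Countable) (φ : C(X, ℝ))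
    (hφ : ∀ x y, (∀ f ∈ F, f x = f y) → φ x = φ y) :
    ∃ ψ : C(evalImage F, ℝ), ∀ x, ψ (toEvalImage F x) = φ x := by
  have := hX.compactSpace_evalImage (hF.insert φ)
  have hsub := subset_insert φ F
  -- Adding `φ` separates no new points, so restriction is a continuous bijection from a compact
  -- space to a Hausdorff one; `ψ` is the `φ`-coordinate of its inverse.
  have hinj : Function.Injective (evalImageMap hsub) := by
    rintro ⟨_, x, rfl⟩ ⟨_, y, rfl⟩ hxy
    have h : ∀ f ∈ F, f x = f y := fun f hf => congrFun (congrArg Subtype.val hxy) ⟨f, hf⟩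
    refine Subtype.ext (funext ?_)
    rintro ⟨f, rfl | hf⟩
    exacts [hφ x y h, h f hf]
  let e := (continuous_evalImageMap hsub).homeoOfEquivCompactToT2
    (f := Equiv.ofBijective _ ⟨hinj, surjective_evalImageMap hsub⟩)
  refine ⟨⟨fun y => (e.symm y).1 ⟨φ, mem_insert φ F⟩,
    (continuous_apply _).comp (continuous_subtype_val.comp e.symm.continuous)⟩, fun x => ?_⟩
  have : e.symm (toEvalImage F x) = toEvalImage _ x := e.symm_apply_eq.2 rfl
  simp only [ContinuousMap.coe_mk, this]
  rfl

end EvaluationImage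

/-! ### Stable families and skeletality -/

section Action

variable {G : Type v} {X : Type u} [Group G] [TopologicalSpace X] [MulAction G X]

/-- All translates of the members of `F` factor continuously through the image of `X` under `F`. -/
def IsTranslationStable (G : Type v) {X : Type u} [Group G] [TopologicalSpace X] [MulAction G X]
    (F : Set C(X, ℝ)) : Prop :=
  ∀ f ∈ F, ∀ g : G, ∃ ψ : C(evalImage F, ℝ), ∀ x, ψ (toEvalImage F x) = f (g • x)

theorem IsTranslationStable.biUnion {ι : Type*} {s : Set ι} {F : ι → Set C(X, ℝ)}
    (h : ∀ i ∈ s, IsTranslationStable G (F i)) : IsTranslationStable G (⋃ i ∈ s, F i) := by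
  intro f hf g
  obtain ⟨i, hi, hfi⟩ := mem_iUnion₂.1 hf
  obtain ⟨ψ, hψ⟩ := h i hi f hfi g
  exact ⟨ψ.comp ⟨_, continuous_evalImageMap (subset_biUnion_of_mem hi)⟩, hψ⟩

theorem IsTranslationStable.exists_map {F : Set C(X, ℝ)} (hF : IsTranslationStable G F) (g : G) :
    ∃ T : C(evalImage F, evalImage F), ∀ x, T (toEvalImage F x) = toEvalImage F (g • x) := by
  choose! ψ hψ using hF
  have hT : ∀ x, (fun f : F => ψ f.1 g (toEvalImage F x)) = fun f : F => f.1 (g • x) :=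
    fun x => funext fun f => hψ f.1 f.2 g x
  have hmem : ∀ y, (fun f : F => ψ f.1 g y) ∈ range fun (x : X) (f : F) => f.1 x :=
    (surjective_toEvalImage F).forall.2 fun x => ⟨g • x, (hT x).symm⟩
  exact ⟨⟨fun y => ⟨_, hmem y⟩,
    Continuous.subtype_mk (continuous_pi fun f : F => (ψ f.1 g).continuous) hmem⟩, fun x =>
    Subtype.ext (hT x)⟩

/-- For `x ∈ U`, the orbit map at `x` pulls `U` back to a neighbourhood of `1`; countably many left
translates of it cover `G`, and transitivity moves the cover to `X`. -/
theorem IsOmegaNarrow.exists_countable_iUnion_smul [TopologicalSpace G] (hG : IsOmegaNarrow G)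
    (hsep : IsSeparatelyContinuousAction G X)
    (htrans : ∀ x : X, Function.Surjective fun g : G => g • x) {U : Set X} (hU : IsOpen U)
    (hne : U.Nonempty) : ∃ A : Set G, A.Countable ∧ ∀ y : X, ∃ a ∈ A, ∃ z ∈ U, a • z = y := by
  obtain ⟨x, hx⟩ := hne
  obtain ⟨A, hA, -, hAU⟩ := hG ((fun g : G => g • x) ⁻¹' U)
    ((hU.preimage (hsep.2 x)).mem_nhds (by simpa using hx))
  refine ⟨A, hA, fun y => ?_⟩
  obtain ⟨g, rfl⟩ := htrans x y
  obtain ⟨a, ha, v, hv, rfl⟩ := mem_mul.1 (hAU ▸ mem_univ g)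
  exact ⟨a, ha, v • x, hv, (mul_smul a v x).symm⟩

theorem IsTranslationStable.isSkeletal_toEvalImage [TopologicalSpace G] (hG : IsOmegaNarrow G)
    (hX : IsPseudocompact X) (hsep : IsSeparatelyContinuousAction G X)
    (htrans : ∀ x : X, Function.Surjective fun g : G => g • x) {F : Set C(X, ℝ)}
    (hF : IsTranslationStable G F) : IsSkeletal (toEvalImage F) := by
  refine ⟨continuous_toEvalImage F, fun U hU hne => ?_⟩
  obtain ⟨A, hA, hcov⟩ := hG.exists_countable_iUnion_smul hsep htrans hU hne
  have : BaireSpace (evalImage F) :=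
    (hX.of_surjective (continuous_toEvalImage F) (surjective_toEvalImage F)).baireSpace
  have : Nonempty (evalImage F) := (hne.image (toEvalImage F)).to_type
  have hunion : ⋃ a ∈ A, closure (toEvalImage F '' ((a • ·) '' U)) = univ := by
    refine eq_univ_of_forall fun y => ?_
    obtain ⟨x, rfl⟩ := surjective_toEvalImage F y
    obtain ⟨a, ha, z, hz, rfl⟩ := hcov x
    exact mem_biUnion ha (subset_closure (mem_image_of_mem _ (mem_image_of_mem _ hz)))
  have := hA.to_subtype
  rw [biUnion_eq_iUnion] at hunion
  obtain ⟨⟨a, ha⟩, w, hw⟩ :=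
    nonempty_interior_of_iUnion_of_closed (fun _ => isClosed_closure) hunion
  obtain ⟨T, hT⟩ := hF.exists_map a
  obtain ⟨T', hT'⟩ := hF.exists_map a⁻¹
  have hinv : ∀ y, T' (T y) = y := (surjective_toEvalImage F).forall.2 fun x => by
    rw [hT, hT', inv_smul_smul]
  have hinv' : ∀ y, T (T' y) = y := (surjective_toEvalImage F).forall.2 fun x => by
    rw [hT', hT, smul_inv_smul]
  -- `T` and `T'` are the mutually inverse actions of `a` and `a⁻¹` on the image; `T'` takes the
  -- interior point `w` back.
  refine ⟨T' w, mem_interior.2 ⟨T ⁻¹' interior (closure (toEvalImage F '' ((a • ·) '' U))), ?_,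
    isOpen_interior.preimage T.continuous, by rwa [mem_preimage, hinv']⟩⟩
  intro y hy
  rw [← hinv y]
  refine map_mem_closure T'.continuous (interior_subset hy) ?_
  rintro _ ⟨_, ⟨z, hz, rfl⟩, rfl⟩
  exact ⟨z, hz, by rw [hT', inv_smul_smul]⟩

/-- For fixed `x` and `y`, the condition `φ x = φ y` is closed under pointwise limits, so it passes
from a countable dense part of the orbit to the whole orbit. -/
theorem IsSAction.exists_countable_determining [TopologicalSpace G] (hs : IsSAction G X)
    (f : C(X, ℝ)) : ∃ A : Set G, A.Countable ∧
      ∀ x y, (∀ a ∈ A, f (a • x) = f (a • y)) → ∀ g : G, f (g • x) = f (g • y) := by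
  have := hs f
  obtain ⟨D, hDc, hDd⟩ := TopologicalSpace.exists_countable_dense (functionOrbit G f)
  choose k hk using fun φ : functionOrbit G f => φ.2
  refine ⟨k '' D, hDc.image k, fun x y hxy g => ?_⟩
  have hcl : IsClosed {φ : functionOrbit G f | φ.1 x = φ.1 y} :=
    isClosed_eq ((continuous_apply x).comp continuous_subtype_val)
      ((continuous_apply y).comp continuous_subtype_val)
  have hD : D ⊆ {φ : functionOrbit G f | φ.1 x = φ.1 y} := fun φ hφ => by
    have := hxy (k φ) (mem_image_of_mem k hφ)
    rw [mem_ofPred_eq, ← hk φ]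
    exact this
  exact closure_minimal hD hcl (hDd (⟨_, g, rfl⟩ : functionOrbit G f))

/-- For an `s`-action on a pseudocompact space, every continuous function lies in a countable family
whose image carries the action. -/
theorem IsSAction.exists_countable_stable [TopologicalSpace G] (hX : IsPseudocompact X)
    (hsep : IsSeparatelyContinuousAction G X) (hs : IsSAction G X) (f : C(X, ℝ)) :
    ∃ F : Set C(X, ℝ), F.Countable ∧ f ∈ F ∧ IsTranslationStable G F := by
  choose A hAc hA using hs.exists_countable_determining
  let tr : G → C(X, ℝ) → C(X, ℝ) := fun g f => f.comp ⟨_, hsep.1 g⟩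
  let step : Set C(X, ℝ) → Set C(X, ℝ) := fun s => ⋃ f ∈ s, (tr · f) '' A f
  let F : ℕ → Set C(X, ℝ) := fun n => n.rec {f} fun _ s => step s
  have hFc : ∀ n, (F n).Countable := by
    intro n
    induction n with
    | zero => exact countable_singleton f
    | succ n ih => exact ih.biUnion fun f _ => (hAc f).image _
  have hc : (⋃ n, F n).Countable := countable_iUnion hFc
  refine ⟨⋃ n, F n, hc, mem_iUnion.2 ⟨0, rfl⟩, fun f' hf' g => ?_⟩
  obtain ⟨n, hn⟩ := mem_iUnion.1 hf'
  refine hX.exists_factorization hc (tr g f') fun x y hxy => hA f' x y (fun a ha => ?_) g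
  exact hxy (tr a f') (mem_iUnion.2 ⟨n + 1, mem_biUnion hn (mem_image_of_mem _ ha)⟩)

end Action

/-! ### The inverse system of a chain of families -/

section System

variable {X : Type u} [TopologicalSpace X]

/-- The system of images of `X` under a monotone well-ordered chain of families of functions. -/
def evalImageSystem (τ : Ordinal.{u}) {F : Ordinal.{u} → Set C(X, ℝ)} (hF : Monotone F) :
    WellOrderedSystem τ where
  space α := evalImage (F α)
  top _ := inferInstance
  tychonoff _ := inferInstance
  map h := evalImageMap (hF h)
  continuous_map h := continuous_evalImageMap (hF h)
  map_refl _ _ := rfl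
  map_map _ _ _ := rfl

variable {τ : Ordinal.{u}} {F : Ordinal.{u} → Set C(X, ℝ)} (hF : Monotone F)

theorem isSkeletal_evalImageSystem_map (hsk : ∀ α, IsSkeletal (toEvalImage (F α)))
    {α β : Iio τ} (h : α ≤ β) : IsSkeletal ((evalImageSystem τ hF).map h) := by
  refine ⟨continuous_evalImageMap (hF h), fun U hU hne => ?_⟩
  have := (hsk α).2 (toEvalImage (F β) ⁻¹' U) (hU.preimage (continuous_toEvalImage _))
    (hne.preimage (surjective_toEvalImage _))
  have himg : (evalImageSystem τ hF).map h '' U =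
      toEvalImage (F α) '' (toEvalImage (F β) ⁻¹' U) := by
    refine Subset.antisymm ?_ ?_
    · rintro _ ⟨y, hy, rfl⟩
      obtain ⟨x, rfl⟩ := surjective_toEvalImage (F β) y
      exact ⟨x, hy, rfl⟩
    · rintro _ ⟨x, hx, rfl⟩
      exact ⟨toEvalImage (F β) x, hx, rfl⟩
  rw [himg]
  exact this

/-- Each coordinate at stage `γ` already occurs earlier, hence the embedding. A basic open set
involves finitely many stages, all below some `α < γ`, and any lift to stage `γ` of the thread's
entry at `α` lands in it, hence density. -/
theorem isAlmostContinuous_evalImageSystem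
    (hlim : ∀ γ, Order.IsSuccLimit γ → F γ ⊆ ⋃ α ∈ Iio γ, F α) :
    (evalImageSystem τ hF).IsAlmostContinuous := by
  intro γ hγ
  let S := evalImageSystem τ hF
  have hcont : Continuous (S.toLimit γ) :=
    Continuous.subtype_mk (continuous_pi fun α => S.continuous_map (le_of_lt α.2)) _
  constructor
  · have hex : ∀ f : F γ, ∃ α : Iio γ, f.1 ∈ F α.1 := fun f => by
      obtain ⟨α, hα, hf⟩ := mem_iUnion₂.1 (hlim γ hγ f.2)
      exact ⟨⟨⟨α, mem_Iio.2 ((mem_Iio.1 hα).trans γ.2)⟩, hα⟩, hf⟩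
    choose r hr using hex
    let ψ : S.limit (Iio γ) → (F γ → ℝ) := fun x f => (x.1 (r f)).1 ⟨f.1, hr f⟩
    have hψ : Continuous ψ := continuous_pi fun f =>
      (continuous_apply (⟨f.1, hr f⟩ : F (r f).1)).comp
        (continuous_subtype_val.comp ((continuous_apply (r f)).comp continuous_subtype_val))
    exact .of_comp hcont hψ IsEmbedding.subtypeVal
  · refine dense_iff_inter_open.2 fun U hU ⟨x, hx⟩ => ?_
    obtain ⟨V, hV, rfl⟩ := isOpen_induced_iff.1 hU
    obtain ⟨I, u, hu, hI⟩ := isOpen_pi_iff.1 hV x.1 hx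
    have h0 : (0 : Ordinal.{u}) < γ := hγ.bot_lt
    have : Nonempty (Iio γ) := ⟨⟨⟨0, h0.trans γ.2⟩, h0⟩⟩
    obtain ⟨α, hα⟩ := I.exists_le
    obtain ⟨y, hy⟩ := surjective_evalImageMap (hF (le_of_lt α.2)) (x.1 α)
    refine ⟨S.toLimit γ y, hI fun i hi => ?_, mem_range_self y⟩
    have hiy : (S.toLimit γ y).1 i = x.1 i := by
      rw [← x.2 i α (hα i hi), ← hy]
      rfl
    rw [hiy]
    exact (hu i hi).2

/-- Stages after `κ` have no new coordinates, so the entry at `κ` determines the thread. -/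
theorem injective_evalImageSystem_proj {κ : Iio τ} (hκ : F κ = univ) :
    Function.Injective ((evalImageSystem τ hF).proj κ) := by
  intro x y hxy
  refine Subtype.ext (funext fun ⟨α, _⟩ => ?_)
  rcases le_total α κ with h | h
  · rw [← x.2 ⟨α, trivial⟩ ⟨κ, trivial⟩ h, ← y.2 ⟨α, trivial⟩ ⟨κ, trivial⟩ h]
    exact congrArg _ hxy
  · have hmap : (evalImageSystem τ hF).map h (x.1 ⟨α, trivial⟩) =
        (evalImageSystem τ hF).map h (y.1 ⟨α, trivial⟩) := by
      rw [x.2 ⟨κ, trivial⟩ ⟨α, trivial⟩ h, y.2 ⟨κ, trivial⟩ ⟨α, trivial⟩ h]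
      exact hxy
    refine Subtype.ext (funext fun f => ?_)
    exact congrFun (congrArg Subtype.val hmap) ⟨f.1, hκ ▸ mem_univ f.1⟩

/-- The canonical map of `X` to the limit of the system of its images. -/
def toEvalImageLimit (x : X) : (evalImageSystem τ hF).fullLimit :=
  ⟨fun α => toEvalImage (F α.1) x, fun _ _ _ => rfl⟩

theorem continuous_toEvalImageLimit :
    Continuous (toEvalImageLimit hF : X → (evalImageSystem τ hF).fullLimit) :=
  Continuous.subtype_mk (continuous_pi fun α => continuous_toEvalImage (F α.1)) _

theorem continuous_evalImageSystem_proj (α : Iio τ) :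
    Continuous ((evalImageSystem τ hF).proj α) :=
  (continuous_apply (⟨α, mem_univ α⟩ : (univ : Set (Iio τ)))).comp continuous_subtype_val

theorem isEmbedding_toEvalImage_of_eq_univ [T35Space X] {H : Set C(X, ℝ)} (hH : H = univ) :
    IsEmbedding (toEvalImage H) := by
  subst hH
  exact isEmbedding_toEvalImage_univ

theorem isAlmostLimit_evalImageSystem [T35Space X] {κ : Iio τ} (hκ : F κ = univ) :
    (evalImageSystem τ hF).IsAlmostLimit X :=
  ⟨toEvalImageLimit hF,
    .of_comp (continuous_toEvalImageLimit hF) (continuous_evalImageSystem_proj hF κ)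
      (isEmbedding_toEvalImage_of_eq_univ hκ),
    fun α => surjective_toEvalImage (F α)⟩

theorem isFactorizing_evalImageSystem [T35Space X] {κ : Iio τ} (hκ : F κ = univ) :
    (evalImageSystem τ hF).IsFactorizing := by
  intro f _
  let j := (isEmbedding_toEvalImage_of_eq_univ hκ).toHomeomorphOfSurjective
    (surjective_toEvalImage (F κ))
  refine ⟨κ, ⟨fun y => f (toEvalImageLimit hF (j.symm y)), f.continuous.comp
    ((continuous_toEvalImageLimit hF).comp j.symm.continuous)⟩, fun x => ?_⟩
  refine congrArg f (injective_evalImageSystem_proj hF hκ ?_)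
  exact (j.apply_symm_apply ((evalImageSystem τ hF).proj κ x)).symm

end System

/-! ### Building the chain -/

/-- If `C(X, ℝ)` is covered by countable families `c f ∋ f` such that the diagonal product of every
union of them is skeletal, then the Tychonoff space `X` is skeletally Dugundji. -/
theorem isSkeletallyDugundji_of_skeletal_unions {X : Type u} [TopologicalSpace X] [T35Space X]
    (c : C(X, ℝ) → Set C(X, ℝ)) (hc : ∀ f, (c f).Countable) (hmem : ∀ f, f ∈ c f)
    (hsk : ∀ s : Set C(X, ℝ), IsSkeletal (toEvalImage (⋃ f ∈ s, c f))) :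
    IsSkeletallyDugundji X := by
  let rk : C(X, ℝ) → Ordinal.{u} := Ordinal.typein WellOrderingRel
  have hrk : Function.Injective rk := Ordinal.typein_injective _
  let κ : Ordinal.{u} := Ordinal.type (WellOrderingRel (α := C(X, ℝ)))
  -- The successor cardinal leaves room for stage `κ`, where the family is all of `C(X, ℝ)`.
  let τ : Cardinal.{u} := Order.succ (Cardinal.mk C(X, ℝ))
  let F : Ordinal.{u} → Set C(X, ℝ) := fun α => ⋃ f ∈ {f | rk f < α}, c f
  have hF : Monotone F := fun α β h => biUnion_subset_biUnion_left fun f (hf : rk f < α) => hf.trans_le h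
  have hκτ : κ < τ.ord := by
    rw [Cardinal.lt_ord, Ordinal.card_type]
    exact Order.lt_succ _
  have hκ : F κ = univ := eq_univ_of_forall fun f =>
    mem_biUnion (Ordinal.typein_lt_type _ f) (hmem f)
  refine ⟨τ, evalImageSystem τ.ord hF, zero_le.trans_lt (Order.lt_succ _), fun α β h =>
    ⟨surjective_evalImageMap (hF h), isSkeletal_evalImageSystem_map hF (fun α => hsk _) h⟩,
    fun α hα => ?_, fun α β h hβ => ?_, isAlmostContinuous_evalImageSystem hF ?_,
    isAlmostLimit_evalImageSystem hF (κ := ⟨κ, hκτ⟩) hκ,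
    isFactorizing_evalImageSystem hF (κ := ⟨κ, hκτ⟩) hκ⟩
  · have hcount : Countable (F α) := by
      have : F α = ∅ := by simp [F, hα]
      simp [this]
    exact ⟨inferInstanceAs (TopologicalSpace.MetrizableSpace (evalImage (F α))),
      inferInstanceAs (TopologicalSpace.SeparableSpace (evalImage (F α)))⟩
  · refine hasMetrizableKernel_evalImageMap (hF h) ?_
    -- Only the function of rank exactly `α` can contribute something new at the next stage.
    have hss : {f | rk f = α}.Subsingleton := fun f hf f' hf' => hrk (hf.trans hf'.symm)
    refine (hss.countable.biUnion fun f _ => hc f).mono ?_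
    rintro f ⟨hfβ, hfα⟩
    obtain ⟨f', hf', hff'⟩ := mem_iUnion₂.1 hfβ
    rw [hβ, mem_ofPred_eq, Order.lt_succ_iff] at hf'
    exact mem_biUnion (hf'.eq_of_not_lt fun hlt => hfα (mem_biUnion hlt hff')) hff'
  · intro γ hγ f hf
    obtain ⟨f', hf', hff'⟩ := mem_iUnion₂.1 hf
    have hlt : f' ∈ {h | rk h < Order.succ (rk f')} := Order.lt_succ (rk f')
    exact mem_biUnion (mem_Iio.2 (hγ.succ_lt (show rk f' < γ from hf'))) (mem_biUnion hlt hff')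

theorem theorem1p5 {G : Type v} {X : Type u} [Group G] [TopologicalSpace G]
    [SeparatelyContinuousMul G] [TopologicalSpace X] [T35Space X] [MulAction G X]
    (hG : IsOmegaNarrow G) (hX : IsPseudocompact X)
    (hsep : IsSeparatelyContinuousAction G X)
    (htrans : ∀ x : X, Function.Surjective fun g : G => g • x)
    (hs : IsSAction G X) :
    IsSkeletallyDugundji X := by
  choose c hc hmem hstable using hs.exists_countable_stable hX hsep
  exact isSkeletallyDugundji_of_skeletal_unions c hc hmem fun s =>
    (IsTranslationStable.biUnion fun f _ => hstable f).isSkeletal_toEvalImage hG hX hsep htrans
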